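/- Let $\mathfrak H_0$ be a complex Hilbert space, let $A_0$ be a bounded self-adjoint operator on $\mathfrak H_0$, let $A_1$ be a self-adjoint operator on $\mathfrak H_1=\mathbb C$, and let $V:\mathbb C\to\mathfrak H_0$ be a bounded linear operator. Let $$\mathbf B=\begin{pmatrix}A_0&V\\V^*&A_1\end{pmatrix}$$ on the orthogonal sum $\mathfrak H=\mathfrak H_0\oplus\mathbb C$. Let $a_1\in\mathbb R$ be the number such that $A_1$ is multiplication by $a_1$, and let $v\in\mathfrak H_0$ be the vector with $V^*x=\langle v,x\rangle$ for all $x\in\mathfrak H_0$ (the inner product is linear in the second argument), that is, $v=V1$. Assume that $\mathfrak H_0$ is the cyclic subspace of $A_0$ generated by $\operatorname{Ran}V$, i.e. the closed linear span of the vectors $A_0^nv$, $n\ge0$. Then $$\phi(z)=\frac{1+(a_1-z)\langle v,(A_0-z)^{-1}v\rangle}{(a_1-z)-\langle v,(A_0-z)^{-1}v\rangle}$$ has a non-vanishing denominator for all $z\in\mathbb C\setminus\mathbb R$ and is a Herglotz function (it is holomorphic in the open upper half-plane and maps it into itself), and there is a positive Borel measure $\omega$ on $\mathbb R$ with compact support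 and total mass $\omega(\mathbb R)=1+\|v\|^2$ such that $$\phi(z)=\int_{\mathbb R}\frac{d\omega(\lambda)}{\lambda-z}\qquad\text{for all }z\in\mathbb C\setminus\mathbb R.$$ Moreover, for this $\omega$, the operator $\mathbf B$ is unitarily equivalent to the operator of multiplication by the independent variable on $L^2(\mathbb R,\omega)$. -/

import Mathlib

open MeasureTheory

noncomputable section

/-- The block operator `[[A₀, V], [V*, A₁]]` on the Hilbert space direct sum `H₀ ⊕ H₁`. -/
def blockOperator {H₀ H₁ : Type*}
    [NormedAddCommGroup H₀] [InnerProductSpace ℂ H₀] [CompleteSpace H₀]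
    [NormedAddCommGroup H₁] [InnerProductSpace ℂ H₁] [CompleteSpace H₁]
    (A₀ : H₀ →L[ℂ] H₀) (A₁ : H₁ →L[ℂ] H₁) (V : H₁ →L[ℂ] H₀) :
    WithLp 2 (H₀ × H₁) →L[ℂ] WithLp 2 (H₀ × H₁) :=
  (WithLp.prodContinuousLinearEquiv 2 ℂ H₀ H₁).symm.toContinuousLinearMap ∘L
    (((A₀ ∘L ContinuousLinearMap.fst ℂ H₀ H₁ + V ∘L ContinuousLinearMap.snd ℂ H₀ H₁).prod
      (ContinuousLinearMap.adjoint V ∘L ContinuousLinearMap.fst ℂ H₀ H₁ +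
        A₁ ∘L ContinuousLinearMap.snd ℂ H₀ H₁)) ∘L
    (WithLp.prodContinuousLinearEquiv 2 ℂ H₀ H₁).toContinuousLinearMap)

theorem blockOperator_toLp {H₀ H₁ : Type*}
    [NormedAddCommGroup H₀] [InnerProductSpace ℂ H₀] [CompleteSpace H₀]
    [NormedAddCommGroup H₁] [InnerProductSpace ℂ H₁] [CompleteSpace H₁]
    (A₀ : H₀ →L[ℂ] H₀) (A₁ : H₁ →L[ℂ] H₁) (V : H₁ →L[ℂ] H₀) (x : H₀) (y : H₁) :
    blockOperator A₀ A₁ V (WithLp.toLp 2 (x, y)) =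
      WithLp.toLp 2 (A₀ x + V y, ContinuousLinearMap.adjoint V x + A₁ y) := rfl

/-- The cyclic subspace of a bounded self-adjoint operator `A` generated by the subspace `S`:
the closed linear span of all vectors `Aⁿ s` with `s ∈ S` and `n ≥ 0`. -/
def cyclicSubspace {H : Type*} [NormedAddCommGroup H] [InnerProductSpace ℂ H]
    (A : H →L[ℂ] H) (S : Submodule ℂ H) : Submodule ℂ H :=
  (Submodule.span ℂ {x : H | ∃ (n : ℕ) (s : H), s ∈ S ∧ x = (A ^ n) s}).topologicalClosure

/-- The real number `a₁` such that the self-adjoint operator `A₁` on `ℂ` is multiplication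
by `a₁`. -/
def multiplier (A₁ : ℂ →L[ℂ] ℂ) : ℝ := (A₁ 1).re

theorem apply_eq_multiplier_mul (A₁ : ℂ →L[ℂ] ℂ) (hA₁ : IsSelfAdjoint A₁) (c : ℂ) :
    A₁ c = (multiplier A₁ : ℂ) * c := by
  have h : inner ℂ (A₁ 1) (1 : ℂ) = inner ℂ (1 : ℂ) (A₁ 1) := by
    have := ContinuousLinearMap.adjoint_inner_left A₁ (1 : ℂ) (1 : ℂ)
    rwa [← ContinuousLinearMap.star_eq_adjoint, hA₁.star_eq] at this
  have h' : ((A₁ 1).re : ℂ) = A₁ 1 := by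
    apply Complex.conj_eq_iff_re.mp
    simpa using h
  have h2 : A₁ c = c * A₁ 1 := by simpa using A₁.map_smul c 1
  rw [h2, multiplier, h', mul_comm]

/-- The vector `v` that represents `V : ℂ → H₀`, that is `V* x = ⟨v, x⟩` for all `x`. -/
def couplingVector {H₀ : Type*} [NormedAddCommGroup H₀] [InnerProductSpace ℂ H₀]
    (V : ℂ →L[ℂ] H₀) : H₀ := V 1

theorem adjoint_apply_eq_inner_couplingVector {H₀ : Type*} [NormedAddCommGroup H₀]
    [InnerProductSpace ℂ H₀] [CompleteSpace H₀] (V : ℂ →L[ℂ] H₀) (x : H₀) :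
    ContinuousLinearMap.adjoint V x = inner ℂ (couplingVector V) x := by
  have := ContinuousLinearMap.adjoint_inner_right V (1 : ℂ) x
  simpa [couplingVector] using this

/-- The scalar function `z ↦ ⟨v, (A₀ - z)⁻¹ v⟩`, for `z` outside the spectrum of `A₀`. -/
def resolventForm {H₀ : Type*} [NormedAddCommGroup H₀] [InnerProductSpace ℂ H₀]
    (A₀ : H₀ →L[ℂ] H₀) (v : H₀) (z : ℂ) : ℂ :=
  inner ℂ v (Ring.inverse (A₀ - z • ContinuousLinearMap.id ℂ H₀) v)

/-- The function
`φ(z) = (1 + (a₁ - z) ⟨v, (A₀ - z)⁻¹ v⟩) / ((a₁ - z) - ⟨v, (A₀ - z)⁻¹ v⟩)`. -/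
def phi {H₀ : Type*} [NormedAddCommGroup H₀] [InnerProductSpace ℂ H₀]
    (A₀ : H₀ →L[ℂ] H₀) (a₁ : ℝ) (v : H₀) (z : ℂ) : ℂ :=
  (1 + ((a₁ : ℂ) - z) * resolventForm A₀ v z) / (((a₁ : ℂ) - z) - resolventForm A₀ v z)

/-- A Herglotz function: holomorphic in the open upper half-plane, which it maps into itself. -/
def IsHerglotz (f : ℂ → ℂ) : Prop :=
  DifferentiableOn ℂ f {z : ℂ | 0 < z.im} ∧ ∀ z : ℂ, 0 < z.im → 0 < (f z).im

/-- The everywhere defined operator `B` is unitarily equivalent to the operator of multiplication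
by the independent variable in `L²(ℝ, ω)`. As the unitary `U` is onto, this includes that the
multiplication operator is everywhere defined. -/
def IsUnitarilyEquivalentToMul {H : Type*} [NormedAddCommGroup H] [InnerProductSpace ℂ H]
    (B : H →L[ℂ] H) (ω : Measure ℝ) : Prop :=
  ∃ U : H ≃ₗᵢ[ℂ] Lp ℂ 2 ω, ∀ x : H, U (B x) =ᵐ[ω] fun t : ℝ => (t : ℂ) * U x t

end

/-! Write `B` for the block operator, `δ = (0, 1)` and `e = (v, i)`. The Schur complement formula
for `(B - z)⁻¹ δ` gives `φ(z) = ⟨e, (B - z)⁻¹ e⟩`, so `φ` is the Cauchy transform of the spectral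
measure `ω` of `B` at `e`, whose mass is `‖e‖² = 1 + ‖v‖²`, and `Im φ(z) = Im z ‖(B - z)⁻¹ e‖²`.

By the spectral theorem, `B` is multiplication by the independent variable in `L²(ω)` as soon as
`e` is cyclic for `B`. The vector `δ` is cyclic: its cyclic subspace contains `B δ - a₁ δ = (v, 0)`
and is invariant under `B`, which on `H₀ ⊕ 0` is `A₀` up to multiples of `δ`. Finally
`e = (B - (a₁ - i)) δ`, where `B - (a₁ - i)` is invertible and commutes with `B`. -/

section RieszMarkovKakutani

open scoped ComplexOrder CompactlySupported

variable {X : Type*} [TopologicalSpace X] [CompactSpace X] [T2Space X] [MeasurableSpace X]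
  [BorelSpace X]

theorem exists_measure_integral_ofReal_eq (φ : C(X, ℂ) →ₚ[ℂ] ℂ) :
    ∃ μ : Measure X, IsFiniteMeasure μ ∧
      ∀ g : C(X, ℝ), ((∫ t, g t ∂μ : ℝ) : ℂ) = φ (g.realToRCLike ℂ) := by
  have φ_real (g : C(X, ℝ)) : ((φ (g.realToRCLike ℂ)).re : ℂ) = φ (g.realToRCLike ℂ) :=
    Complex.conj_eq_iff_re.mp (IsSelfAdjoint.map (ContinuousMap.isSelfAdjoint_realToRCLike ℂ) φ)
  let Λ₀ : C_c(X, ℝ) →ₗ[ℝ] ℝ :=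
    { toFun := fun g => (φ (g.toContinuousMap.realToRCLike ℂ)).re
      map_add' := fun f g => by
        rw [← Complex.add_re, ← map_add]
        congr 2
        ext t
        simp
      map_smul' := fun c g => by
        have : (c • g).toContinuousMap.realToRCLike ℂ
            = (c : ℂ) • g.toContinuousMap.realToRCLike ℂ := by
          ext t
          simp
        simp [this] }
  let Λ : C_c(X, ℝ) →ₚ[ℝ] ℝ := PositiveLinearMap.mk₀ Λ₀ fun g hg =>
    (Complex.nonneg_iff.mp (map_nonneg φ (show 0 ≤ g.toContinuousMap.realToRCLike ℂ from
      fun t => Complex.zero_le_real.mpr (hg t)))).1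
  refine ⟨RealRMK.rieszMeasure Λ, inferInstance, fun g => ?_⟩
  rw [← φ_real]
  exact congrArg _ (RealRMK.integral_rieszMeasure Λ
    (CompactlySupportedContinuousMap.continuousMapEquiv g))

theorem exists_measure_integral_eq (φ : C(X, ℂ) →ₚ[ℂ] ℂ) :
    ∃ μ : Measure X, IsFiniteMeasure μ ∧ ∀ f : C(X, ℂ), φ f = ∫ t, f t ∂μ := by
  obtain ⟨μ, hμ, integral_ofReal⟩ := exists_measure_integral_ofReal_eq φ
  refine ⟨μ, hμ, fun f => ?_⟩
  let u : C(X, ℝ) := ⟨fun t => (f t).re, by fun_prop⟩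
  let v : C(X, ℝ) := ⟨fun t => (f t).im, by fun_prop⟩
  have hf : f = u.realToRCLike ℂ + Complex.I • v.realToRCLike ℂ := by
    ext t
    simpa [u, v, mul_comm] using (Complex.re_add_im (f t)).symm
  have hint : Integrable f μ :=
    f.continuous.integrable_of_hasCompactSupport (HasCompactSupport.of_compactSpace f)
  calc φ f = φ (u.realToRCLike ℂ) + Complex.I * φ (v.realToRCLike ℂ) := by
        conv_lhs => rw [hf, map_add, map_smul, smul_eq_mul]
    _ = ∫ t, f t ∂μ := by
        rw [← integral_ofReal, ← integral_ofReal, mul_comm]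
        exact integral_re_add_im hint

variable {H : Type*} [NormedAddCommGroup H] [InnerProductSpace ℂ H] [CompleteSpace H]

theorem exists_measure_inner_starAlgHom_apply_eq (T : C(X, ℂ) →⋆ₐ[ℂ] (H →L[ℂ] H)) (x : H) :
    ∃ μ : Measure X, IsFiniteMeasure μ ∧ ∀ f : C(X, ℂ), inner ℂ x (T f x) = ∫ t, f t ∂μ :=
  let vectorState : C(X, ℂ) →ₗ[ℂ] ℂ :=
    (innerSL ℂ x).toLinearMap ∘ₗ (ContinuousLinearMap.apply ℂ H x).toLinearMap ∘ₗ T.toLinearMap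
  exists_measure_integral_eq <| PositiveLinearMap.mk₀ vectorState fun _ hf =>
    ((ContinuousLinearMap.nonneg_iff_isPositive _).mp (map_nonneg T hf)).inner_nonneg_right x

end RieszMarkovKakutani

section FunctionalCalculus

variable {A : Type*} [CStarAlgebra A] {a : A}

theorem isUnit_sub_smul_one (ha : IsSelfAdjoint a) {z : ℂ} (hz : z.im ≠ 0) :
    IsUnit (a - z • (1 : A)) := by
  have hspec : z ∉ spectrum ℂ a := fun h => hz <| by
    rw [ha.mem_spectrum_eq_re h, Complex.ofReal_im]
  rw [← neg_sub, ← Algebra.algebraMap_eq_smul_one]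
  exact (spectrum.notMem_iff.mp hspec).neg

/-- The continuous functional calculus of a self-adjoint element, for complex-valued functions of
a real variable. The spectrum is a subset of `ℂ` here, and a function on `ℝ` is evaluated at the
real part of its points. -/
noncomputable def realFunctionalCalculus (ha : IsSelfAdjoint a) : C(ℝ, ℂ) →⋆ₐ[ℂ] A :=
  (cfcHom ha.isStarNormal).comp
    (ContinuousMap.compStarAlgHom' ℂ ℂ ⟨fun s : spectrum ℂ a => (s : ℂ).re, by fun_prop⟩)

/-- The inclusion of `ℝ` in `ℂ`, which is the independent variable among the complex-valued
functions on the real line. -/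
def ofRealMap : C(ℝ, ℂ) := ⟨Complex.ofReal, Complex.continuous_ofReal⟩

theorem realFunctionalCalculus_ofRealMap (ha : IsSelfAdjoint a) :
    realFunctionalCalculus ha ofRealMap = a := by
  refine Eq.trans (congrArg (cfcHom ha.isStarNormal) ?_) (cfcHom_id ha.isStarNormal)
  ext s
  exact (ha.mem_spectrum_eq_re s.2).symm

theorem ofReal_sub_ne_zero {z : ℂ} (hz : z.im ≠ 0) (t : ℝ) : (t : ℂ) - z ≠ 0 :=
  fun h => hz (by simpa using congrArg Complex.im h)

/-- The function `t ↦ (t - z)⁻¹` on the real line, for non-real `z`. -/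
noncomputable def cauchyKernel {z : ℂ} (hz : z.im ≠ 0) : C(ℝ, ℂ) :=
  ⟨fun t => ((t : ℂ) - z)⁻¹, by
    have := ofReal_sub_ne_zero hz
    fun_prop (disch := assumption)⟩

theorem realFunctionalCalculus_cauchyKernel (ha : IsSelfAdjoint a) {z : ℂ} (hz : z.im ≠ 0) :
    realFunctionalCalculus ha (cauchyKernel hz) = Ring.inverse (a - z • (1 : A)) := by
  rw [← one_mul (Ring.inverse _), Ring.eq_mul_inverse_iff_mul_eq _ _ _ (isUnit_sub_smul_one ha hz)]
  have hmul : cauchyKernel hz * (ofRealMap - z • 1) = 1 := by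
    ext t
    simpa [cauchyKernel, ofRealMap] using inv_mul_cancel₀ (ofReal_sub_ne_zero hz t)
  simpa [realFunctionalCalculus_ofRealMap] using congrArg (realFunctionalCalculus ha) hmul

end FunctionalCalculus

section SpectralMeasure

variable {H : Type*} [NormedAddCommGroup H] [InnerProductSpace ℂ H] [CompleteSpace H]
  {B : H →L[ℂ] H} {x : H} {ω : Measure ℝ}

/-- `ω` is the spectral measure of the self-adjoint operator `B` at the vector `x`: it is finite,
has compact support, and `⟨x, f(B) x⟩ = ∫ f dω` for every continuous function `f`. -/
structure IsSpectralMeasure (hB : IsSelfAdjoint B) (x : H) (ω : Measure ℝ) : Prop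
    extends IsFiniteMeasure ω where
  isCompact_support : IsCompact ω.support
  inner_apply_eq_integral : ∀ f : C(ℝ, ℂ),
    inner ℂ x (realFunctionalCalculus hB f x) = ∫ t, f t ∂ω

theorem exists_isSpectralMeasure (hB : IsSelfAdjoint B) (x : H) :
    ∃ ω : Measure ℝ, IsSpectralMeasure hB x ω := by
  have : CompactSpace (spectrum ℂ B) := isCompact_iff_compactSpace.mp (spectrum.isCompact B)
  obtain ⟨μ, hμ, inner_eq⟩ := exists_measure_inner_starAlgHom_apply_eq (cfcHom hB.isStarNormal) x
  let ρ : C(spectrum ℂ B, ℝ) := ⟨fun s => (s : ℂ).re, by fun_prop⟩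
  have hρ : AEMeasurable ρ μ := ρ.continuous.aemeasurable
  refine ⟨μ.map ρ, inferInstance, ?_, fun f => ?_⟩
  · have hrange : IsCompact (Set.range ρ) := isCompact_range ρ.continuous
    refine hrange.of_isClosed_subset Measure.isClosed_support
      (Measure.support_subset_of_isClosed hrange.isClosed ?_)
    exact (ae_map_iff hρ hrange.isClosed.measurableSet).mpr (.of_forall Set.mem_range_self)
  · rw [integral_map hρ f.continuous.aestronglyMeasurable]
    exact inner_eq (f.comp ρ)

namespace IsSpectralMeasure

variable {hB : IsSelfAdjoint B}

theorem measure_univ (hω : IsSpectralMeasure hB x ω) :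
    ω Set.univ = ENNReal.ofReal (‖x‖ ^ 2) := by
  have := hω.toIsFiniteMeasure
  have hmass : ((‖x‖ ^ 2 : ℝ) : ℂ) = (ω.real Set.univ : ℝ) := by
    simpa [inner_self_eq_norm_sq_to_K] using hω.inner_apply_eq_integral 1
  rw [Complex.ofReal_injective hmass, ofReal_measureReal]

theorem resolventForm_eq_integral (hω : IsSpectralMeasure hB x ω) {z : ℂ}
    (hz : z.im ≠ 0) : resolventForm B x z = ∫ t : ℝ, ((t : ℂ) - z)⁻¹ ∂ω := by
  have h := hω.inner_apply_eq_integral (cauchyKernel hz)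
  rwa [realFunctionalCalculus_cauchyKernel] at h

theorem inner_apply_apply_eq_integral (hω : IsSpectralMeasure hB x ω)
    (f g : C(ℝ, ℂ)) :
    inner ℂ (realFunctionalCalculus hB f x) (realFunctionalCalculus hB g x) =
      ∫ t, inner ℂ (f t) (g t) ∂ω := by
  calc inner ℂ (realFunctionalCalculus hB f x) (realFunctionalCalculus hB g x)
      = inner ℂ x (realFunctionalCalculus hB (star f * g) x) := by
        rw [map_mul, map_star, mul_apply_eq_comp, ContinuousLinearMap.star_eq_adjoint,
          ContinuousLinearMap.adjoint_inner_right]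
    _ = ∫ t, inner ℂ (f t) (g t) ∂ω := by
        rw [hω.inner_apply_eq_integral]
        simp [mul_comm]

end IsSpectralMeasure

end SpectralMeasure

section MultiplicationOperator

open scoped ENNReal

section ContinuousToLp

variable {𝕜 X : Type*} [RCLike 𝕜] [TopologicalSpace X] [HereditarilyLindelofSpace X]
  [MeasurableSpace X]

theorem memLp_of_isCompact_support [OpensMeasurableSpace X] {ω : Measure X} [IsFiniteMeasure ω]
    (hω : IsCompact ω.support) (p : ℝ≥0∞) (f : C(X, 𝕜)) : MemLp f p ω := by
  obtain ⟨C, hC⟩ := hω.exists_bound_of_continuousOn f.continuous.continuousOn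
  exact MemLp.of_bound f.continuous.aestronglyMeasurable C
    (Filter.mem_of_superset Measure.support_mem_ae hC)

/-- The map from the continuous functions to `Lᵖ`, for a finite measure of compact support. -/
noncomputable def continuousToLp [OpensMeasurableSpace X] {ω : Measure X} [IsFiniteMeasure ω]
    (hω : IsCompact ω.support) (p : ℝ≥0∞) : C(X, 𝕜) →ₗ[𝕜] Lp 𝕜 p ω where
  toFun f := (memLp_of_isCompact_support hω p f).toLp f
  map_add' _ _ := rfl
  map_smul' _ _ := rfl

theorem coeFn_continuousToLp [OpensMeasurableSpace X] {ω : Measure X} [IsFiniteMeasure ω]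
    (hω : IsCompact ω.support) (p : ℝ≥0∞) (f : C(X, 𝕜)) : continuousToLp hω p f =ᵐ[ω] f :=
  (memLp_of_isCompact_support hω p f).coeFn_toLp

theorem denseRange_continuousToLp [BorelSpace X] [NormalSpace X] {ω : Measure X}
    [IsFiniteMeasure ω] [ω.WeaklyRegular] (hω : IsCompact ω.support) {p : ℝ≥0∞}
    [Fact (1 ≤ p)] (hp : p ≠ ∞) : DenseRange (continuousToLp (𝕜 := 𝕜) hω p) := by
  refine (BoundedContinuousFunction.toLp_denseRange 𝕜 ω 𝕜 hp).mono ?_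
  rintro _ ⟨g, rfl⟩
  refine ⟨g.toContinuousMap, Lp.ext ?_⟩
  exact (coeFn_continuousToLp hω p _).trans (BoundedContinuousFunction.coeFn_toLp p ω 𝕜 g).symm

end ContinuousToLp

variable {ω : Measure ℝ}

/-- Multiplication by the independent variable on `L²`, for a finite measure of compact support. -/
noncomputable def mulIdL2 [IsFiniteMeasure ω] (hω : IsCompact ω.support) :
    Lp ℂ 2 ω →L[ℂ] Lp ℂ 2 ω :=
  (ContinuousLinearMap.mul ℂ ℂ).holderL ω ∞ 2 2 (continuousToLp hω ∞ ofRealMap)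

theorem coeFn_mulIdL2 [IsFiniteMeasure ω] (hω : IsCompact ω.support) (F : Lp ℂ 2 ω) :
    mulIdL2 hω F =ᵐ[ω] fun t : ℝ => (t : ℂ) * F t := by
  filter_upwards [(ContinuousLinearMap.mul ℂ ℂ).coeFn_holder (r := 2)
    (continuousToLp hω ∞ ofRealMap) F,
    coeFn_continuousToLp hω ∞ ofRealMap] with t hmul hid
  rw [hid] at hmul
  exact hmul

theorem mulIdL2_continuousToLp [IsFiniteMeasure ω] (hω : IsCompact ω.support) (f : C(ℝ, ℂ)) :
    mulIdL2 hω (continuousToLp hω 2 f) = continuousToLp hω 2 (ofRealMap * f) := by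
  refine Lp.ext ?_
  filter_upwards [coeFn_mulIdL2 hω (continuousToLp hω 2 f), coeFn_continuousToLp hω 2 f,
    coeFn_continuousToLp hω 2 (ofRealMap * f)] with t hmul hf hprod
  rw [hmul, hf, hprod]
  rfl

end MultiplicationOperator

theorem exists_linearIsometryEquiv_of_norm_eq {𝕜 E F G : Type*} [NontriviallyNormedField 𝕜]
    [AddCommGroup E] [Module 𝕜 E]
    [NormedAddCommGroup F] [NormedSpace 𝕜 F] [CompleteSpace F]
    [NormedAddCommGroup G] [NormedSpace 𝕜 G] [CompleteSpace G]
    {f : E →ₗ[𝕜] F} {g : E →ₗ[𝕜] G} (hf : DenseRange f) (hg : DenseRange g)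
    (hnorm : ∀ x, ‖g x‖ = ‖f x‖) : ∃ U : F ≃ₗᵢ[𝕜] G, ∀ x, U (f x) = g x :=
  ⟨(LinearEquiv.refl 𝕜 E).extendOfIsometry f g hf hg hnorm,
    LinearEquiv.extendOfIsometry_eq _ _ _ hf hg hnorm⟩

section SpectralRepresentation

variable {H : Type*} [NormedAddCommGroup H] [InnerProductSpace ℂ H] [CompleteSpace H]
  {B : H →L[ℂ] H} {x : H} {ω : Measure ℝ}

/-- The map `f ↦ f(B) x`, which the spectral representation of `B` at `x` inverts. -/
noncomputable def functionalCalculusOrbit (hB : IsSelfAdjoint B) (x : H) : C(ℝ, ℂ) →ₗ[ℂ] H :=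
  (ContinuousLinearMap.apply ℂ H x).toLinearMap ∘ₗ (realFunctionalCalculus hB).toLinearMap

theorem functionalCalculusOrbit_ofRealMap_mul (hB : IsSelfAdjoint B) (x : H) (f : C(ℝ, ℂ)) :
    functionalCalculusOrbit hB x (ofRealMap * f) = B (functionalCalculusOrbit hB x f) := by
  simp [functionalCalculusOrbit, realFunctionalCalculus_ofRealMap]

theorem denseRange_functionalCalculusOrbit (hB : IsSelfAdjoint B)
    (hx : cyclicSubspace B (ℂ ∙ x) = ⊤) : DenseRange (functionalCalculusOrbit hB x) := by
  refine (Submodule.dense_iff_topologicalClosure_eq_top.mpr hx).mono ?_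
  rw [← LinearMap.coe_range, SetLike.coe_subset_coe, Submodule.span_le]
  rintro _ ⟨n, s, hs, rfl⟩
  obtain ⟨c, rfl⟩ := Submodule.mem_span_singleton.mp hs
  refine ⟨c • ofRealMap ^ n, ?_⟩
  simp [functionalCalculusOrbit, realFunctionalCalculus_ofRealMap]

theorem IsSpectralMeasure.norm_continuousToLp [IsFiniteMeasure ω] {hB : IsSelfAdjoint B}
    (hω : IsSpectralMeasure hB x ω) (f : C(ℝ, ℂ)) :
    ‖continuousToLp hω.isCompact_support 2 f‖ = ‖functionalCalculusOrbit hB x f‖ := by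
  have hinner : inner ℂ (continuousToLp hω.isCompact_support 2 f)
      (continuousToLp hω.isCompact_support 2 f) =
        inner ℂ (functionalCalculusOrbit hB x f) (functionalCalculusOrbit hB x f) := by
    refine Eq.trans ?_ (hω.inner_apply_apply_eq_integral f f).symm
    rw [L2.inner_def]
    refine integral_congr_ae ?_
    filter_upwards [coeFn_continuousToLp hω.isCompact_support 2 f] with t ht
    rw [ht]
  rw [norm_eq_sqrt_re_inner (𝕜 := ℂ), hinner, ← norm_eq_sqrt_re_inner]

theorem IsSpectralMeasure.isUnitarilyEquivalentToMul {hB : IsSelfAdjoint B}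
    (hω : IsSpectralMeasure hB x ω) (hx : cyclicSubspace B (ℂ ∙ x) = ⊤) :
    IsUnitarilyEquivalentToMul B ω := by
  have := hω.toIsFiniteMeasure
  have hsupp := hω.isCompact_support
  have horbit := denseRange_functionalCalculusOrbit hB hx
  obtain ⟨U, U_orbit⟩ : ∃ U : H ≃ₗᵢ[ℂ] Lp ℂ 2 ω, ∀ f : C(ℝ, ℂ),
      U (functionalCalculusOrbit hB x f) = continuousToLp hsupp 2 f :=
    exists_linearIsometryEquiv_of_norm_eq horbit
      (denseRange_continuousToLp hsupp ENNReal.ofNat_ne_top) hω.norm_continuousToLp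
  have intertwine (y : H) : U (B y) = mulIdL2 hsupp (U y) := by
    refine horbit.induction_on y (isClosed_eq (U.continuous.comp B.continuous)
      ((mulIdL2 hsupp).continuous.comp U.continuous)) fun f => ?_
    rw [← functionalCalculusOrbit_ofRealMap_mul, U_orbit, U_orbit, mulIdL2_continuousToLp]
  refine ⟨U, fun y => ?_⟩
  rw [intertwine]
  exact coeFn_mulIdL2 hsupp (U y)

end SpectralRepresentation

theorem inverse_apply_eq_iff {R M : Type*} [Ring R] [AddCommGroup M] [TopologicalSpace M]
    [IsTopologicalAddGroup M] [Module R M] {T : M →L[R] M} (hT : IsUnit T) {x y : M} :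
    Ring.inverse T x = y ↔ T y = x := by
  constructor
  · rintro rfl
    exact congrArg (fun S : M →L[R] M => S x) (Ring.mul_inverse_cancel T hT)
  · rintro rfl
    exact congrArg (fun S : M →L[R] M => S y) (Ring.inverse_mul_cancel T hT)

theorem IsHerglotz.congr {f g : ℂ → ℂ} (hf : IsHerglotz f)
    (hfg : ∀ z : ℂ, 0 < z.im → g z = f z) : IsHerglotz g :=
  ⟨hf.1.congr hfg, fun z hz => hfg z hz ▸ hf.2 z hz⟩

section Resolvent

variable {H : Type*} [NormedAddCommGroup H] [InnerProductSpace ℂ H] [CompleteSpace H]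
  {B : H →L[ℂ] H} {z : ℂ}

theorem inverse_sub_smul_id_apply_eq_iff (hB : IsSelfAdjoint B) (hz : z.im ≠ 0) {x y : H} :
    Ring.inverse (B - z • ContinuousLinearMap.id ℂ H) x = y ↔ B y - z • y = x :=
  inverse_apply_eq_iff (isUnit_sub_smul_one hB hz)

theorem im_inner_sub_smul_apply (hB : IsSelfAdjoint B) (z : ℂ) (x : H) :
    (inner ℂ (B x - z • x) x).im = z.im * ‖x‖ ^ 2 := by
  have him : (inner ℂ (B x) x).im = 0 := hB.isSymmetric.im_inner_apply_self x
  rw [inner_sub_left, inner_smul_left, inner_self_eq_norm_sq_to_K, Complex.sub_im, him]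
  simp [← Complex.ofReal_pow]

theorem im_resolventForm (hB : IsSelfAdjoint B) (hz : z.im ≠ 0) (x : H) :
    (resolventForm B x z).im =
      z.im * ‖Ring.inverse (B - z • ContinuousLinearMap.id ℂ H) x‖ ^ 2 := by
  rw [← im_inner_sub_smul_apply hB, (inverse_sub_smul_id_apply_eq_iff hB hz).mp rfl, resolventForm]

theorem sub_resolventForm_ne_zero (hB : IsSelfAdjoint B) (hz : z.im ≠ 0) (a : ℝ) (x : H) :
    (a : ℂ) - z - resolventForm B x z ≠ 0 := by
  intro h
  have him : z.im * (1 + ‖Ring.inverse (B - z • ContinuousLinearMap.id ℂ H) x‖ ^ 2) = 0 := by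
    have := congrArg Complex.im h
    rw [Complex.sub_im, Complex.sub_im, im_resolventForm hB hz, Complex.ofReal_im,
      Complex.zero_im] at this
    linarith
  exact mul_ne_zero hz (by positivity) him

theorem differentiableAt_resolventForm (hB : IsSelfAdjoint B) (hz : z.im ≠ 0) (x : H) :
    DifferentiableAt ℂ (resolventForm B x) z := by
  have hpencil : DifferentiableAt ℂ (fun w : ℂ => B - w • ContinuousLinearMap.id ℂ H) z := by
    fun_prop
  have hinv : DifferentiableAt ℂ (Ring.inverse (M₀ := H →L[ℂ] H))
      (B - z • ContinuousLinearMap.id ℂ H) :=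
    differentiableAt_inverse (isUnit_sub_smul_one hB hz)
  have hresolvent : DifferentiableAt ℂ
      (fun w : ℂ => Ring.inverse (B - w • ContinuousLinearMap.id ℂ H)) z :=
    DifferentiableAt.comp (g := Ring.inverse (M₀ := H →L[ℂ] H)) z hinv hpencil
  exact (innerSL ℂ x).differentiableAt.comp z (hresolvent.clm_apply (differentiableAt_const x))

theorem isHerglotz_resolventForm (hB : IsSelfAdjoint B) {x : H} (hx : x ≠ 0) :
    IsHerglotz (resolventForm B x) := by
  refine ⟨fun z hz => (differentiableAt_resolventForm hB (ne_of_gt hz) x).differentiableWithinAt,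
    fun z hz => ?_⟩
  have hinv : Ring.inverse (B - z • ContinuousLinearMap.id ℂ H) x ≠ 0 := fun h =>
    hx (by simpa using ((inverse_sub_smul_id_apply_eq_iff hB hz.ne').mp h).symm)
  rw [im_resolventForm hB hz.ne']
  positivity

end Resolvent

section CyclicSubspace

variable {H : Type*} [NormedAddCommGroup H] [InnerProductSpace ℂ H] {A : H →L[ℂ] H}
  {S M : Submodule ℂ H}

theorem isClosed_cyclicSubspace : IsClosed (cyclicSubspace A S : Set H) :=
  Submodule.isClosed_topologicalClosure _

theorem cyclicSubspace_le (hM : IsClosed (M : Set H)) (hSM : S ≤ M) (hAM : ∀ x ∈ M, A x ∈ M) :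
    cyclicSubspace A S ≤ M := by
  refine Submodule.topologicalClosure_minimal _ (Submodule.span_le.mpr ?_) hM
  rintro _ ⟨n, s, hs, rfl⟩
  induction n with
  | zero => exact hSM hs
  | succ n ih => exact pow_succ' A n ▸ hAM _ ih

theorem le_cyclicSubspace : S ≤ cyclicSubspace A S := fun s hs =>
  Submodule.le_topologicalClosure _ (Submodule.subset_span ⟨0, s, hs, rfl⟩)

theorem apply_mem_cyclicSubspace {x : H} (hx : x ∈ cyclicSubspace A S) :
    A x ∈ cyclicSubspace A S := by
  refine Submodule.topologicalClosure_minimal (t := (cyclicSubspace A S).comap A.toLinearMap) _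
    (Submodule.span_le.mpr ?_) (isClosed_cyclicSubspace.preimage A.continuous) hx
  rintro _ ⟨n, s, hs, rfl⟩
  exact Submodule.le_topologicalClosure _
    (Submodule.subset_span ⟨n + 1, s, hs, by rw [pow_succ']; rfl⟩)

theorem cyclicSubspace_map_eq_top {T : H →L[ℂ] H} (hTA : Commute T A) (hT : DenseRange T)
    (hS : cyclicSubspace A S = ⊤) : cyclicSubspace A (S.map T.toLinearMap) = ⊤ := by
  set C := cyclicSubspace A (S.map T.toLinearMap)
  have hC : cyclicSubspace A S ≤ C.comap T.toLinearMap :=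
    cyclicSubspace_le (isClosed_cyclicSubspace.preimage T.continuous)
      (fun s hs => le_cyclicSubspace (Submodule.mem_map_of_mem hs)) fun x hx => by
        have hcomm : T (A x) = A (T x) := congrArg (fun R : H →L[ℂ] H => R x) hTA.eq
        exact (hcomm ▸ apply_mem_cyclicSubspace hx : T (A x) ∈ C)
  refine Submodule.eq_top_iff'.mpr fun y => hT.induction_on y isClosed_cyclicSubspace fun x => ?_
  exact hC (hS ▸ Submodule.mem_top)

end CyclicSubspace

section BlockOperator

variable {H₀ H₁ : Type*}
  [NormedAddCommGroup H₀] [InnerProductSpace ℂ H₀] [CompleteSpace H₀]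
  [NormedAddCommGroup H₁] [InnerProductSpace ℂ H₁] [CompleteSpace H₁]
  {A₀ : H₀ →L[ℂ] H₀} {A₁ : H₁ →L[ℂ] H₁} {V : H₁ →L[ℂ] H₀}

theorem isSelfAdjoint_blockOperator (hA₀ : IsSelfAdjoint A₀) (hA₁ : IsSelfAdjoint A₁)
    (V : H₁ →L[ℂ] H₀) : IsSelfAdjoint (blockOperator A₀ A₁ V) := by
  rw [ContinuousLinearMap.isSelfAdjoint_iff_isSymmetric]
  rintro ⟨x, c⟩ ⟨y, d⟩
  have h₀ : inner ℂ (A₀ x) y = inner ℂ x (A₀ y) := hA₀.isSymmetric x y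
  have h₁ : inner ℂ (A₁ c) d = inner ℂ c (A₁ d) := hA₁.isSymmetric c d
  change inner ℂ (blockOperator A₀ A₁ V (WithLp.toLp 2 (x, c))) (WithLp.toLp 2 (y, d)) =
    inner ℂ (WithLp.toLp 2 (x, c)) (blockOperator A₀ A₁ V (WithLp.toLp 2 (y, d)))
  simp only [blockOperator_toLp, WithLp.prod_inner_apply, inner_add_left, inner_add_right, h₀, h₁,
    ContinuousLinearMap.adjoint_inner_left, ContinuousLinearMap.adjoint_inner_right]
  ring

theorem eq_top_of_forall_blockOperator_mem (hcyc : cyclicSubspace A₀ V.range = ⊤)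
    {M : Submodule ℂ (WithLp 2 (H₀ × H₁))} (hM : IsClosed (M : Set (WithLp 2 (H₀ × H₁))))
    (hBM : ∀ w ∈ M, blockOperator A₀ A₁ V w ∈ M) (hinr : ∀ y : H₁, WithLp.toLp 2 (0, y) ∈ M) :
    M = ⊤ := by
  let inl : H₀ →L[ℂ] WithLp 2 (H₀ × H₁) :=
    (WithLp.prodContinuousLinearEquiv 2 ℂ H₀ H₁).symm.toContinuousLinearMap ∘L
      ContinuousLinearMap.inl ℂ H₀ H₁
  have hinl : cyclicSubspace A₀ V.range ≤ M.comap inl.toLinearMap := by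
    refine cyclicSubspace_le (hM.preimage inl.continuous) ?_ fun x hx => ?_
    · rintro _ ⟨y, rfl⟩
      have h : inl (V y) =
          blockOperator A₀ A₁ V (WithLp.toLp 2 (0, y)) - WithLp.toLp 2 (0, A₁ y) := by
        simp [inl, blockOperator_toLp, ← WithLp.toLp_sub]
      exact (h ▸ M.sub_mem (hBM _ (hinr y)) (hinr _) : inl (V y) ∈ M)
    · have h : inl (A₀ x) =
          blockOperator A₀ A₁ V (inl x) - WithLp.toLp 2 (0, ContinuousLinearMap.adjoint V x) := by
        simp [inl, blockOperator_toLp, ← WithLp.toLp_sub]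
      exact (h ▸ M.sub_mem (hBM _ hx) (hinr _) : inl (A₀ x) ∈ M)
  refine Submodule.eq_top_iff'.mpr fun w => ?_
  obtain ⟨x, y⟩ := w
  have hx : inl x ∈ M := hinl (hcyc ▸ Submodule.mem_top)
  have h : WithLp.toLp 2 (x, y) = inl x + WithLp.toLp 2 (0, y) := by
    simp [inl, ← WithLp.toLp_add]
  exact h ▸ M.add_mem hx (hinr y)

end BlockOperator

section BlockCyclicVector

/-- The vector `(v, i)`, at which the resolvent form of the block operator is `phi`. -/
def blockCyclicVector {E : Type*} (v : E) : WithLp 2 (E × ℂ) := WithLp.toLp 2 (v, Complex.I)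

theorem norm_sq_blockCyclicVector {E : Type*} [NormedAddCommGroup E] (v : E) :
    ‖blockCyclicVector v‖ ^ 2 = 1 + ‖v‖ ^ 2 := by
  rw [WithLp.prod_norm_sq_eq_of_L2]
  simp [blockCyclicVector, add_comm]

theorem blockCyclicVector_ne_zero {E : Type*} [NormedAddCommGroup E] (v : E) :
    blockCyclicVector v ≠ 0 := fun h =>
  Complex.I_ne_zero (congrArg WithLp.snd h)

variable {H₀ : Type*} [NormedAddCommGroup H₀] [InnerProductSpace ℂ H₀] [CompleteSpace H₀]
  {A₀ : H₀ →L[ℂ] H₀} {A₁ : ℂ →L[ℂ] ℂ} {V : ℂ →L[ℂ] H₀}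

theorem blockOperator_toLp_complex (A₀ : H₀ →L[ℂ] H₀) (hA₁ : IsSelfAdjoint A₁) (V : ℂ →L[ℂ] H₀)
    (x : H₀) (c : ℂ) :
    blockOperator A₀ A₁ V (WithLp.toLp 2 (x, c)) =
      WithLp.toLp 2 (A₀ x + c • couplingVector V,
        inner ℂ (couplingVector V) x + multiplier A₁ * c) := by
  have hV : V c = c • couplingVector V := by simpa [couplingVector] using V.map_smul c 1
  rw [blockOperator_toLp, adjoint_apply_eq_inner_couplingVector, apply_eq_multiplier_mul A₁ hA₁, hV]

theorem blockCyclicVector_eq_blockOperator_sub_smul (A₀ : H₀ →L[ℂ] H₀) (hA₁ : IsSelfAdjoint A₁)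
    (V : ℂ →L[ℂ] H₀) (z : ℂ) :
    blockCyclicVector (couplingVector V) =
      blockOperator A₀ A₁ V (WithLp.toLp 2 (0, 1)) - z • WithLp.toLp 2 (0, 1) +
        (z - multiplier A₁ + Complex.I) • WithLp.toLp 2 (0, 1) := by
  simp only [blockCyclicVector, blockOperator_toLp_complex A₀ hA₁, map_zero, one_smul, zero_add,
    inner_zero_right, mul_one, ← WithLp.toLp_smul, Prod.smul_mk, smul_zero, smul_eq_mul,
    ← WithLp.toLp_sub, Prod.mk_sub_mk, sub_zero, ← WithLp.toLp_add, Prod.mk_add_mk, add_zero,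
    WithLp.toLp.injEq, Prod.mk.injEq, true_and]
  ring

theorem cyclicSubspace_blockOperator_span_inr_one (hcyc : cyclicSubspace A₀ V.range = ⊤) :
    cyclicSubspace (blockOperator A₀ A₁ V) (ℂ ∙ WithLp.toLp 2 (0, 1)) = ⊤ := by
  refine eq_top_of_forall_blockOperator_mem hcyc isClosed_cyclicSubspace
    (fun _ => apply_mem_cyclicSubspace) fun c => le_cyclicSubspace ?_
  refine Submodule.mem_span_singleton.mpr ⟨c, ?_⟩
  simp [← WithLp.toLp_smul]

theorem cyclicSubspace_blockOperator_span_blockCyclicVector (hA₀ : IsSelfAdjoint A₀)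
    (hA₁ : IsSelfAdjoint A₁) (hcyc : cyclicSubspace A₀ V.range = ⊤) :
    cyclicSubspace (blockOperator A₀ A₁ V) (ℂ ∙ blockCyclicVector (couplingVector V)) = ⊤ := by
  set B := blockOperator A₀ A₁ V
  set T := B - ((multiplier A₁ : ℂ) - Complex.I) • ContinuousLinearMap.id ℂ (WithLp 2 (H₀ × ℂ))
  have hunit : IsUnit T :=
    isUnit_sub_smul_one (isSelfAdjoint_blockOperator hA₀ hA₁ V) (by simp)
  have hcomm : Commute T B :=
    (Commute.refl B).sub_left ((Commute.one_left B).smul_left _)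
  have hT : T (WithLp.toLp 2 (0, 1)) = blockCyclicVector (couplingVector V) := by
    simp [blockCyclicVector_eq_blockOperator_sub_smul A₀ hA₁ V (multiplier A₁ - Complex.I), T, B]
  have hspan : (ℂ ∙ WithLp.toLp 2 ((0 : H₀), (1 : ℂ))).map T.toLinearMap =
      ℂ ∙ blockCyclicVector (couplingVector V) := by
    rw [Submodule.map_span, Set.image_singleton, ← hT]
    rfl
  have hsurj : Function.Surjective T := fun y =>
    ⟨Ring.inverse T y, (inverse_apply_eq_iff hunit).mp rfl⟩
  rw [← hspan]
  exact cyclicSubspace_map_eq_top hcomm hsurj.denseRange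
    (cyclicSubspace_blockOperator_span_inr_one hcyc)

theorem inverse_blockOperator_sub_smul_inr_one (hA₀ : IsSelfAdjoint A₀) (hA₁ : IsSelfAdjoint A₁)
    (V : ℂ →L[ℂ] H₀) {z : ℂ} (hz : z.im ≠ 0) :
    Ring.inverse (blockOperator A₀ A₁ V - z • ContinuousLinearMap.id ℂ (WithLp 2 (H₀ × ℂ)))
        (WithLp.toLp 2 (0, 1)) =
      (multiplier A₁ - z - resolventForm A₀ (couplingVector V) z)⁻¹ • WithLp.toLp 2
        (-Ring.inverse (A₀ - z • ContinuousLinearMap.id ℂ H₀) (couplingVector V), (1 : ℂ)) := by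
  have hD := sub_resolventForm_ne_zero hA₀ hz (multiplier A₁) (couplingVector V)
  rw [inverse_sub_smul_id_apply_eq_iff (isSelfAdjoint_blockOperator hA₀ hA₁ V) hz, map_smul,
    smul_comm z, ← smul_sub, inv_smul_eq_iff₀ hD, blockOperator_toLp_complex _ hA₁]
  have hr := (inverse_sub_smul_id_apply_eq_iff hA₀ hz (x := couplingVector V)).mp rfl
  rw [← WithLp.toLp_smul, ← WithLp.toLp_sub, ← WithLp.toLp_smul]
  congr 1
  refine Prod.ext ?_ ?_
  · simp [eq_add_of_sub_eq hr]
  · simp only [resolventForm, Prod.snd_sub, Prod.smul_mk, inner_neg_right, smul_eq_mul, mul_one]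
    ring

theorem resolventForm_blockOperator (hA₀ : IsSelfAdjoint A₀) (hA₁ : IsSelfAdjoint A₁)
    (V : ℂ →L[ℂ] H₀) {z : ℂ} (hz : z.im ≠ 0) :
    resolventForm (blockOperator A₀ A₁ V) (blockCyclicVector (couplingVector V)) z =
      phi A₀ (multiplier A₁) (couplingVector V) z := by
  have hD := sub_resolventForm_ne_zero hA₀ hz (multiplier A₁) (couplingVector V)
  set R := Ring.inverse
    (blockOperator A₀ A₁ V - z • ContinuousLinearMap.id ℂ (WithLp 2 (H₀ × ℂ))) with hR
  have hinv : R (blockCyclicVector (couplingVector V)) =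
      WithLp.toLp 2 (0, 1) + (z - multiplier A₁ + Complex.I) • R (WithLp.toLp 2 (0, 1)) := by
    conv_lhs => rw [blockCyclicVector_eq_blockOperator_sub_smul A₀ hA₁ V z, map_add, map_smul]
    congr 1
    exact (inverse_sub_smul_id_apply_eq_iff (isSelfAdjoint_blockOperator hA₀ hA₁ V) hz).mpr rfl
  rw [resolventForm, ← hR, hinv, hR, inverse_blockOperator_sub_smul_inr_one hA₀ hA₁ V hz, phi,
    inner_add_right, inner_smul_right, inner_smul_right, WithLp.prod_inner_apply,
    WithLp.prod_inner_apply]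
  simp only [blockCyclicVector, inner_zero_right, inner_neg_right, RCLike.inner_apply,
    Complex.conj_I, mul_neg, one_mul, zero_add]
  rw [← resolventForm]
  field_simp
  linear_combination -Complex.I_sq

end BlockCyclicVector

theorem theorem3p2 {H₀ : Type*} [NormedAddCommGroup H₀] [InnerProductSpace ℂ H₀]
    [CompleteSpace H₀]
    (A₀ : H₀ →L[ℂ] H₀) (hA₀ : IsSelfAdjoint A₀)
    (A₁ : ℂ →L[ℂ] ℂ) (hA₁ : IsSelfAdjoint A₁)
    (V : ℂ →L[ℂ] H₀)
    (hcyc : cyclicSubspace A₀ V.range = ⊤) :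
    IsHerglotz (phi A₀ (multiplier A₁) (couplingVector V)) ∧
    ∃ ω : Measure ℝ,
      ω Set.univ = ENNReal.ofReal (1 + ‖couplingVector V‖ ^ 2) ∧
      IsCompact ω.support ∧
      (∀ z : ℂ, z.im ≠ 0 →
        multiplier A₁ - z - resolventForm A₀ (couplingVector V) z ≠ 0 ∧
        phi A₀ (multiplier A₁) (couplingVector V) z = ∫ t : ℝ, ((t : ℂ) - z)⁻¹ ∂ω) ∧
      IsUnitarilyEquivalentToMul (blockOperator A₀ A₁ V) ω := by
  have hB := isSelfAdjoint_blockOperator hA₀ hA₁ V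
  have hphi {z : ℂ} (hz : z.im ≠ 0) := resolventForm_blockOperator hA₀ hA₁ V hz
  obtain ⟨ω, hω⟩ := exists_isSpectralMeasure hB (blockCyclicVector (couplingVector V))
  refine ⟨?_, ω, ?_, hω.isCompact_support,
    fun z hz => ⟨sub_resolventForm_ne_zero hA₀ hz _ _, ?_⟩, hω.isUnitarilyEquivalentToMul
      (cyclicSubspace_blockOperator_span_blockCyclicVector hA₀ hA₁ hcyc)⟩
  · exact (isHerglotz_resolventForm hB (blockCyclicVector_ne_zero _)).congr
      fun z hz => (hphi hz.ne').symm
  · rw [hω.measure_univ, norm_sq_blockCyclicVector]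
  · rw [← hphi hz, hω.resolventForm_eq_integral hz]
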